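/- A latin square of order $n$ is an $n\times n$ array on $n$ symbols in which each symbol occurs exactly once in every row and in every column. A subsquare of order $m$ is an $m\times m$ subarray (formed by some $m$ rows and some $m$ columns) that is itself a latin square on some set of $m$ symbols; two subsquares are disjoint if they share no rows, no columns and no symbols. An $\mathrm{ILS}(n;h_1h_2h_3)$ is a latin square of order $n$ with three pairwise disjoint subsquares, of orders $h_1$, $h_2$ and $h_3$. Theorem. Let $h_1\ge h_2\ge h_3\ge 1$ and $h_4\ge 0$ be integers, and let $n=h_1+h_2+h_3+h_4$. - If $h_4\ge h_1$, then an $\mathrm{ILS}(n;h_1h_2h_3)$ exists. - If $h_1>h_4\ge h_3$, then an $\mathrm{ILS}(n;h_1h_2h_3)$ exists if and only if $h_4\ge h_1-h_3$. - If $h_4<h_3$, then an $\mathrm{ILS}(n;h_1h_2h_3)$ exists if and only if $h_4\ge h_2+h_3-\frac{2h_2h_3}{h_1}$ and $h_4^2+h_4(2h_1-h_2-h_3)-h_1h_2-h_1h_3+2h_2h_3\ge 0$. -/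

import Mathlib

/-- `L` is a latin square of order `n`: rows, columns and symbols are indexed by `Fin n`, and each
symbol occurs exactly once in every row and exactly once in every column. -/
def IsLatinSquare {n : ℕ} (L : Fin n → Fin n → Fin n) : Prop :=
  (∀ r s, ∃! c, L r c = s) ∧ (∀ c s, ∃! r, L r c = s)

/-- A choice of rows, columns and symbols of an array of order `n`. -/
structure SubarrayData (n : ℕ) where
  rows : Finset (Fin n)
  cols : Finset (Fin n)
  syms : Finset (Fin n)

/-- The subarray of `L` on the rows `T.rows` and the columns `T.cols` is a latin square of
order `m` on the symbol set `T.syms`. -/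
structure IsSubsquare {n : ℕ} (L : Fin n → Fin n → Fin n) (m : ℕ) (T : SubarrayData n) :
    Prop where
  card_rows : T.rows.card = m
  card_cols : T.cols.card = m
  card_syms : T.syms.card = m
  entry_mem : ∀ r ∈ T.rows, ∀ c ∈ T.cols, L r c ∈ T.syms
  row_latin : ∀ r ∈ T.rows, ∀ s ∈ T.syms, ∃! c, c ∈ T.cols ∧ L r c = s
  col_latin : ∀ c ∈ T.cols, ∀ s ∈ T.syms, ∃! r, r ∈ T.rows ∧ L r c = s

/-- Two subsquares are disjoint if they share no rows, no columns and no symbols. -/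
def SubarrayData.DisjointFrom {n : ℕ} (T U : SubarrayData n) : Prop :=
  Disjoint T.rows U.rows ∧ Disjoint T.cols U.cols ∧ Disjoint T.syms U.syms

/-- `L` is an incomplete latin square `ILS(n; h₁ … h_k)`: a latin square of order `n` with
pairwise disjoint subsquares of orders `h 0, …, h (k - 1)`. -/
def IsILS {n k : ℕ} (h : Fin k → ℕ) (L : Fin n → Fin n → Fin n) : Prop :=
  IsLatinSquare L ∧
    ∃ T : Fin k → SubarrayData n,
      (∀ i, IsSubsquare L (h i) (T i)) ∧ ∀ i j, i ≠ j → (T i).DisjointFrom (T j)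

/-- An `ILS(n; h₁ … h_k)` exists. -/
def ILSExists (n : ℕ) {k : ℕ} (h : Fin k → ℕ) : Prop :=
  ∃ L : Fin n → Fin n → Fin n, IsILS h L

/-!
The proof reduces the existence of a latin square with subsquares to the existence of its outline
array, in the manner of Hilton's amalgamated latin squares. Put the rows, columns and symbols of
the `i`-th subsquare into class `some i`, of size `hᵢ`, and all the others into class `none`, of size
`h₄`, and let `F i j k` count the cells in row class `i` and column class `j` with a symbol of class
`k`. The line sums of `F` are the products of the class sizes, and `F i i i = hᵢ²` for each
subsquare (`exists_isOutline_of_ilsExists`). Conversely, every array `F` over `ℕ` with these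
properties comes from a latin square (`ilsExists_of_isOutline`): a slice of `F` at a row class of
size `d` is a bipartite multigraph whose degrees are divisible by `d`, hence by Hall's theorem a sum
of `d` graphs with `1 / d` of the degrees (`exists_decomposition_of_sums_eq_mul`), which splits the
class into single rows; columns and symbols are split in the same way.

For three subsquares such an `F` is determined by its six values `F i j k` at permutations `(i, j, k)`
of the three classes. Call these the transversal cells. The other values are nonnegative exactly if
each transversal value is at most `h₂ * h₃`, two transversal values that share class `i` in the same
coordinate have sum at least `Aᵢ = hᵢ * (hⱼ + hₖ - h₄)`, and the sum of all six is at most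
`B = h₄² - h₄ * (h₁ + h₂ + h₃) + 2 * (h₁ * h₂ + h₁ * h₃ + h₂ * h₃)`. Each such pair consists of an
even and an odd permutation, and for fixed `i` the three pairs partition the six cells. So nothing
is lost by giving all even cells the same value `e` and all odd cells the same value `o`,
and an incomplete latin square exists if and only if some `A = e + o` satisfies `0 ≤ A`, `Aᵢ ≤ A`,
`A ≤ 2 * h₂ * h₃` and `3 * A ≤ B` (`ilsExists_three_iff`). The cases of the theorem correspond to which
of the `Aᵢ` is the largest.
-/

/-! ### Splitting regular bipartite multigraphs -/

open Finset in
/-- A regular bipartite multigraph has a perfect matching: `E` is the set of edges, `l` and `r` give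
the endpoints, and the matching is encoded as the choice `g` of an edge at each left vertex. -/
theorem exists_section_bijective_of_regular {E X Y : Type*} [Fintype E] [Fintype X] [Fintype Y]
    [DecidableEq X] [DecidableEq Y] (l : E → X) (r : E → Y) {d : ℕ} (hd : 0 < d)
    (hl : ∀ x, #{e | l e = x} = d) (hr : ∀ y, #{e | r e = y} = d) :
    ∃ g : X → E, (∀ x, l (g x) = x) ∧ Function.Bijective (r ∘ g) := by
  classical
  obtain ⟨f, hf, hfe⟩ := (Finset.all_card_le_biUnion_card_iff_exists_injective
    (fun x => univ.filter (fun y => ∃ e, l e = x ∧ r e = y))).1 (by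
      intro s
      -- Hall's condition: all `d * #s` edges at `s` end in the neighbourhood of `s`,
      -- which receives at most `d` edges per vertex.
      refine Nat.le_of_mul_le_mul_left ?_ hd
      refine (mul_card_image_le_card_of_maps_to (f := l) (s := {e | l e ∈ s}) (by simp) d ?_).trans
        (card_le_mul_card_image_of_maps_to (f := r) ?_ d ?_)
      · intro x hx
        rw [← hl x]
        refine card_le_card fun e he => ?_
        simp only [mem_filter, mem_univ, true_and] at he ⊢
        exact ⟨he ▸ hx, he⟩
      · intro e he
        simp only [mem_filter, mem_univ, true_and, mem_biUnion] at he ⊢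
        exact ⟨_, he, e, rfl, rfl⟩
      · intro y _
        rw [← hr y]
        exact card_le_card (filter_subset_filter _ (subset_univ _)))
  simp only [mem_filter, mem_univ, true_and] at hfe
  choose g hg hgf using hfe
  refine ⟨g, hg, ?_⟩
  have hcard : Fintype.card X = Fintype.card Y := by
    have h1 := card_eq_sum_card_fiberwise (f := l) (s := univ) (t := univ) (by simp [Set.MapsTo])
    have h2 := card_eq_sum_card_fiberwise (f := r) (s := univ) (t := univ) (by simp [Set.MapsTo])
    simp only [hl, hr, sum_const, smul_eq_mul, card_univ] at h1 h2
    exact Nat.eq_of_mul_eq_mul_right hd (h1.symm.trans h2)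
  have : r ∘ g = f := funext hgf
  rw [this]
  exact (Fintype.bijective_iff_injective_and_card f).2 ⟨hf, hcard⟩

open Finset in
/-- A vertex `j` of degree `d * b j` can be split into `b j` vertices of degree `d`. -/
theorem exists_lift_card_fiber_eq {E α : Type*} [Fintype E] [Fintype α] [DecidableEq α]
    (f : E → α) (d : ℕ) (b : α → ℕ) (hf : ∀ j, #{e | f e = j} = d * b j) :
    ∃ l : E → Σ j, Fin (b j), (∀ e, (l e).1 = f e) ∧ ∀ x, #{e | l e = x} = d := by
  classical
  have el : ∀ j, Nonempty ({e // f e = j} ≃ Fin (b j) × Fin d) := fun j =>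
    Fintype.card_eq.1 (by simp [Fintype.card_subtype, hf, mul_comm])
  obtain ⟨el⟩ := Classical.nonempty_pi.2 el
  refine ⟨fun e => ⟨f e, (el (f e) ⟨e, rfl⟩).1⟩, fun e => rfl, ?_⟩
  rintro ⟨j, t⟩
  refine Eq.trans (Eq.symm ?_) (Finset.card_fin d)
  refine Finset.card_bij (fun u _ => ((el j).symm (t, u)).1) ?_ ?_ ?_
  · intro u _
    have h : el j ((el j).symm (t, u)) = (t, u) := Equiv.apply_symm_apply _ _
    generalize (el j).symm (t, u) = x at h ⊢
    obtain ⟨e, rfl⟩ := x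
    simp [h]
  · intro u _ v _ h
    simpa using (el j).symm.injective (Subtype.ext h)
  · intro e he
    simp only [mem_filter, mem_univ, true_and] at he
    obtain ⟨rfl, he⟩ := Sigma.mk.inj he
    refine ⟨(el (f e) ⟨e, rfl⟩).2, mem_univ _, ?_⟩
    simp [← eq_of_heq he]

open Finset in
theorem card_filter_sigma_fst {ι : Type*} [Fintype ι] (w : ι → ℕ) (q : ι → Prop)
    [DecidablePred q] : #{x : Σ i, Fin (w i) | q x.1} = ∑ i with q i, w i := by
  have : ({x | q x.1} : Finset (Σ i, Fin (w i))) =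
      ({i | q i} : Finset ι).sigma fun i => (univ : Finset (Fin (w i))) := by
    ext x
    simp only [mem_filter, mem_univ, true_and, mem_sigma, and_true]
  rw [this, card_sigma]
  simp

open Finset in
theorem card_filter_sigma_fst_eq {ι : Type*} [Fintype ι] [DecidableEq ι] (w : ι → ℕ) (i : ι) :
    #{x : Σ i, Fin (w i) | x.1 = i} = w i := by
  rw [card_filter_sigma_fst w (· = i), filter_eq', if_pos (mem_univ i), sum_singleton]

open Finset in
/-- Integral scaling: if a matrix `M` over `ℕ` has line sums `d * b` and `d * c`, then below it lies a
matrix with line sums `b` and `c`. Regard `M` as edge multiplicities, split the vertices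
into vertices of degree `d`, and take a perfect matching. -/
theorem exists_factor_of_sums_eq_mul {α β : Type*} [Fintype α] [Fintype β]
    (M : α → β → ℕ) {d : ℕ} (hd : 0 < d) (b : α → ℕ) (c : β → ℕ)
    (hb : ∀ j, ∑ k, M j k = d * b j) (hc : ∀ k, ∑ j, M j k = d * c k) :
    ∃ N : α → β → ℕ, (∀ j k, N j k ≤ M j k) ∧ (∀ j, ∑ k, N j k = b j) ∧
      ∀ k, ∑ j, N j k = c k := by
  classical
  let E := Σ p : α × β, Fin (M p.1 p.2)
  obtain ⟨l, hl, hl'⟩ := exists_lift_card_fiber_eq (fun e : E => e.1.1) d b fun j => by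
    rw [card_filter_sigma_fst (fun p : α × β => M p.1 p.2) (fun p => p.1 = j), sum_filter, Fintype.sum_prod_type]
    simp [← hb, Finset.sum_ite_irrel]
  obtain ⟨r, hr, hr'⟩ := exists_lift_card_fiber_eq (fun e : E => e.1.2) d c fun k => by
    rw [card_filter_sigma_fst (fun p : α × β => M p.1 p.2) (fun p => p.2 = k), sum_filter, Fintype.sum_prod_type]
    simp [← hc]
  obtain ⟨g, hg, hgr⟩ := exists_section_bijective_of_regular l r hd hl' hr'
  refine ⟨fun j k => #{x | x.1 = j ∧ (r (g x)).1 = k}, fun j k => ?_, fun j => ?_, fun k => ?_⟩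
  · have h := card_filter_sigma_fst (fun p : α × β => M p.1 p.2) (· = (j, k))
    simp only [filter_eq', mem_univ, if_true, sum_singleton] at h
    rw [← h]
    refine card_le_card_of_injOn g ?_ fun x _ y _ hxy => by rw [← hg x, hxy, hg y]
    intro x hx
    simp only [coe_filter, mem_univ, true_and, Set.mem_ofPred_eq] at hx ⊢
    rw [hr] at hx
    have := hl (g x)
    rw [hg] at this
    exact Prod.ext (this ▸ hx.1) hx.2
  · rw [← card_filter_sigma_fst_eq b j, card_eq_sum_card_fiberwise (f := fun x => (r (g x)).1) (t := univ)
      (by simp [Set.MapsTo])]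
    simp only [filter_filter]
  · rw [← card_filter_sigma_fst_eq c k,
      ← card_bijective (s := ({x | (r (g x)).1 = k} : Finset (Σ j, Fin (b j)))) _ hgr (by simp),
      card_eq_sum_card_fiberwise (f := fun x => x.1) (t := univ) (by simp [Set.MapsTo])]
    simp only [filter_filter, and_comm]

theorem exists_decomposition_of_sums_eq_mul {α β : Type*} [Fintype α] [Fintype β] (d : ℕ)
    (M : α → β → ℕ) (b : α → ℕ) (c : β → ℕ)
    (hb : ∀ j, ∑ k, M j k = d * b j) (hc : ∀ k, ∑ j, M j k = d * c k) :
    ∃ N : Fin d → α → β → ℕ, (∀ t j, ∑ k, N t j k = b j) ∧ (∀ t k, ∑ j, N t j k = c k) ∧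
      ∀ j k, ∑ t, N t j k = M j k := by
  induction d generalizing M with
  | zero =>
    refine ⟨fun _ _ _ => 0, fun t => t.elim0, fun t => t.elim0, fun j k => ?_⟩
    have h := hb j
    rw [zero_mul, Finset.sum_eq_zero_iff] at h
    simp [h k (Finset.mem_univ k)]
  | succ d ih =>
    obtain ⟨N₀, hN₀, hb₀, hc₀⟩ := exists_factor_of_sums_eq_mul M d.succ_pos b c hb hc
    obtain ⟨N, hNb, hNc, hN⟩ := ih (fun j k => M j k - N₀ j k)
      (fun j => by
        rw [Finset.sum_tsub_distrib _ fun k _ => hN₀ j k, hb, hb₀, add_mul, one_mul,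
          Nat.add_sub_cancel])
      (fun k => by
        rw [Finset.sum_tsub_distrib _ fun j _ => hN₀ j k, hc, hc₀, add_mul, one_mul,
          Nat.add_sub_cancel])
    refine ⟨Fin.cons N₀ N, fun t j => ?_, fun t k => ?_, fun j k => ?_⟩
    · cases t using Fin.cases <;> simp [hb₀, hNb]
    · cases t using Fin.cases <;> simp [hc₀, hNc]
    · simp [Fin.sum_univ_succ, hN, Nat.add_sub_cancel' (hN₀ j k)]

/-! ### Outline arrays, their splittings and amalgamations -/

/-- `F` is an outline array with weights `a`, `b`, `c`: `F i j k` counts the cells in row class `i`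
and column class `j` that hold a symbol of class `k`, where the classes have sizes `a i`, `b j`
and `c k`. If all weights are `1`, this is the indicator function of a latin square. -/
structure IsOutline {ι κ μ : Type*} [Fintype ι] [Fintype κ] [Fintype μ]
    (a : ι → ℕ) (b : κ → ℕ) (c : μ → ℕ) (F : ι → κ → μ → ℕ) : Prop where
  sum_syms : ∀ i j, ∑ k, F i j k = a i * b j
  sum_cols : ∀ i k, ∑ j, F i j k = a i * c k
  sum_rows : ∀ j k, ∑ i, F i j k = b j * c k

namespace IsOutline

variable {ι κ μ : Type*} [Fintype ι] [Fintype κ] [Fintype μ]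
  {a : ι → ℕ} {b : κ → ℕ} {c : μ → ℕ} {F : ι → κ → μ → ℕ}

/-- Rows, columns and symbols play the same role, so that a construction on rows applies
to columns and symbols as well. -/
theorem rotate (hF : IsOutline a b c F) : IsOutline b c a fun j k i => F i j k where
  sum_syms := hF.sum_rows
  sum_cols j i := by rw [hF.sum_syms, mul_comm]
  sum_rows k i := by rw [hF.sum_cols, mul_comm]

/-- Each row class can be split into single rows. -/
theorem exists_split (hF : IsOutline a b c F) :
    ∃ G : (Σ i, Fin (a i)) → κ → μ → ℕ, IsOutline (fun _ => 1) b c G ∧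
      ∀ i j k, ∑ t, G ⟨i, t⟩ j k = F i j k := by
  choose N hNb hNc hN using fun i =>
    exists_decomposition_of_sums_eq_mul (a i) (F i) b c (hF.sum_syms i) (hF.sum_cols i)
  refine ⟨fun x => N x.1 x.2, ⟨fun x j => by simp [hNb], fun x k => by simp [hNc], fun j k => ?_⟩,
    hN⟩
  rw [Fintype.sum_sigma]
  simp [hN, hF.sum_rows]

/-- Every outline array comes from one with all weights `1`, that is, from a latin square. Of the
relation between the two only the supports are recorded. -/
theorem exists_split_all (hF : IsOutline a b c F) :
    ∃ G : (Σ i, Fin (a i)) → (Σ j, Fin (b j)) → (Σ k, Fin (c k)) → ℕ,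
      IsOutline (fun _ => 1) (fun _ => 1) (fun _ => 1) G ∧
      ∀ x y z, G x y z ≠ 0 → F x.1 y.1 z.1 ≠ 0 := by
  obtain ⟨G₁, h₁, e₁⟩ := hF.exists_split
  obtain ⟨G₂, h₂, e₂⟩ := h₁.rotate.exists_split
  obtain ⟨G₃, h₃, e₃⟩ := h₂.rotate.exists_split
  refine ⟨fun x y z => G₃ z x y, h₃.rotate, fun x y z h => ?_⟩
  obtain ⟨i, t⟩ := x
  obtain ⟨j, u⟩ := y
  obtain ⟨k, v⟩ := z
  rw [← Nat.pos_iff_ne_zero] at h ⊢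
  have s₃ := Finset.single_le_sum (f := fun v => G₃ ⟨k, v⟩ ⟨i, t⟩ ⟨j, u⟩)
    (fun _ _ => Nat.zero_le _) (Finset.mem_univ v)
  have s₂ := Finset.single_le_sum (f := fun u => G₂ ⟨j, u⟩ k ⟨i, t⟩)
    (fun _ _ => Nat.zero_le _) (Finset.mem_univ u)
  have s₁ := Finset.single_le_sum (f := fun t => G₁ ⟨i, t⟩ j k)
    (fun _ _ => Nat.zero_le _) (Finset.mem_univ t)
  simp only [e₁, e₂, e₃] at s₁ s₂ s₃
  exact h.trans_le (s₃.trans (s₂.trans s₁))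

open Finset in
/-- Rows can be amalgamated along any map `p`. -/
theorem merge {ι' : Type*} [Fintype ι'] [DecidableEq ι'] (hF : IsOutline a b c F) (p : ι → ι') :
    IsOutline (fun i' => ∑ i with p i = i', a i) b c fun i' j k => ∑ i with p i = i', F i j k where
  sum_syms i' j := by rw [sum_comm, sum_mul]; simp [hF.sum_syms]
  sum_cols i' k := by rw [sum_comm, sum_mul]; simp [hF.sum_cols]
  sum_rows j k := by rw [sum_fiberwise, hF.sum_rows]

open Finset in
theorem merge_all {ι' κ' μ' : Type*} [Fintype ι'] [DecidableEq ι'] [Fintype κ'] [DecidableEq κ']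
    [Fintype μ'] [DecidableEq μ'] (hF : IsOutline a b c F) (p : ι → ι') (q : κ → κ') (r : μ → μ') :
    IsOutline (fun i' => ∑ i with p i = i', a i) (fun j' => ∑ j with q j = j', b j)
      (fun k' => ∑ k with r k = k', c k) fun i' j' k' =>
        ∑ k with r k = k', ∑ j with q j = j', ∑ i with p i = i', F i j k :=
  (((hF.merge p).rotate.merge q).rotate.merge r).rotate

end IsOutline

open Finset in
theorem IsLatinSquare.isOutline {n : ℕ} {L : Fin n → Fin n → Fin n} (hL : IsLatinSquare L) :
    IsOutline (fun _ => 1) (fun _ => 1) (fun _ => 1) fun r c s => if L r c = s then 1 else 0 where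
  sum_syms r c := by simp
  sum_cols r s := by
    rw [← card_filter, one_mul, card_eq_one]
    obtain ⟨c, hc, h⟩ := hL.1 r s
    exact ⟨c, by ext x; simpa using ⟨h x, fun hx => hx ▸ hc⟩⟩
  sum_rows c s := by
    rw [← card_filter, one_mul, card_eq_one]
    obtain ⟨r, hr, h⟩ := hL.2 c s
    exact ⟨r, by ext x; simpa using ⟨h x, fun hx => hx ▸ hr⟩⟩

theorem existsUnique_ne_zero_of_sum_eq_one {α : Type*} [Fintype α] {f : α → ℕ}
    (h : ∑ x, f x = 1) : ∃! x, f x ≠ 0 := by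
  classical
  obtain ⟨x, -, hx⟩ := Finset.exists_ne_zero_of_sum_ne_zero (h.trans_ne one_ne_zero)
  refine ⟨x, hx, fun y hy => ?_⟩
  by_contra hne
  have := Finset.sum_le_sum_of_subset (f := f) (Finset.subset_univ {y, x})
  rw [Finset.sum_pair hne, h] at this
  omega

/-! ### Incomplete latin squares as outline arrays -/

open Finset in
/-- Disjoint sets `A i` as classes: `p` sends the points of `A i` to `some i` and
the `m` remaining points to `none`. -/
theorem exists_class_map {n m k : ℕ} {h : Fin k → ℕ} (hn : ∑ i, h i + m = n)
    (A : Fin k → Finset (Fin n)) (hA : ∀ i, #(A i) = h i)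
    (hd : ∀ i j, i ≠ j → Disjoint (A i) (A j)) :
    ∃ p : Fin n → Option (Fin k), (∀ i x, p x = some i ↔ x ∈ A i) ∧
      (fun i => ∑ x with p x = i, 1) = fun i => Option.elim i m h := by
  classical
  let p : Fin n → Option (Fin k) := fun x => if hx : ∃ i, x ∈ A i then some hx.choose else none
  have hp : ∀ i x, p x = some i ↔ x ∈ A i := by
    intro i x
    by_cases hx : ∃ i, x ∈ A i
    · simp only [p, dif_pos hx, Option.some.injEq]
      refine ⟨fun e => e ▸ hx.choose_spec, fun hi => ?_⟩
      by_contra hne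
      exact (disjoint_left.1 (hd _ _ hne) hx.choose_spec) hi
    · simp only [p, dif_neg hx, reduceCtorEq, false_iff]
      exact fun hi => hx ⟨i, hi⟩
  have hs : ∀ i, #{x | p x = some i} = h i := by
    intro i
    rw [← hA i]
    congr 1
    ext x
    simp [hp]
  refine ⟨p, hp, funext fun i => ?_⟩
  rw [sum_const, smul_eq_mul, mul_one]
  cases i with
  | some i => exact hs i
  | none =>
    have := card_eq_sum_card_fiberwise (f := p) (s := univ) (t := univ) (by simp [Set.MapsTo])
    rw [Fintype.sum_option, card_fin] at this
    simp only [hs] at this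
    simp only [Option.elim]
    omega

open Finset in
theorem exists_isOutline_of_ilsExists {n m k : ℕ} {h : Fin k → ℕ} (hn : ∑ i, h i + m = n)
    (H : ILSExists n h) :
    ∃ F, IsOutline (Option.elim · m h) (Option.elim · m h) (Option.elim · m h) F ∧
      ∀ i, F (some i) (some i) (some i) = h i * h i := by
  obtain ⟨L, hL, T, hT, hd⟩ := H
  obtain ⟨p, hp, ep⟩ := exists_class_map hn _ (fun i => (hT i).card_rows)
    fun i j hij => (hd i j hij).1
  obtain ⟨q, hq, e_q⟩ := exists_class_map hn _ (fun i => (hT i).card_cols)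
    fun i j hij => (hd i j hij).2.1
  obtain ⟨r, hr, er⟩ := exists_class_map hn _ (fun i => (hT i).card_syms)
    fun i j hij => (hd i j hij).2.2
  have hF := hL.isOutline.merge_all p q r
  rw [ep, e_q, er] at hF
  refine ⟨_, hF, fun i => ?_⟩
  have hf : ∀ j ∈ (T i).cols, ∀ l ∈ (T i).rows, L l j ∈ (T i).syms :=
    fun j hj l hl => (hT i).entry_mem l hl j hj
  simp only [hp, hq, hr, filter_univ_mem]
  rw [sum_comm, ← (hT i).card_cols, ← smul_eq_mul, ← sum_const]
  refine (sum_congr rfl fun j hj => ?_)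
  rw [sum_comm, (hT i).card_cols, ← (hT i).card_rows, card_eq_sum_ones]
  exact sum_congr rfl fun l hl => by simp [hf j hj l hl]

namespace IsOutline

variable {k m : ℕ} {h : Fin k → ℕ} {F : Option (Fin k) → Option (Fin k) → Option (Fin k) → ℕ}

/-- If cell `(i, i)` is filled with symbol `i` alone, no other symbol class meets it. -/
theorem eq_zero_of_diag
    (hF : IsOutline (Option.elim · m h) (Option.elim · m h) (Option.elim · m h) F) {i : Fin k}
    (hi : F (some i) (some i) (some i) = h i * h i) {x : Option (Fin k)} (hx : x ≠ some i) :
    F (some i) (some i) x = 0 := by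
  have hs := hF.sum_syms (some i) (some i)
  have := Finset.sum_le_sum_of_subset (f := F (some i) (some i))
    (Finset.subset_univ {x, some i})
  rw [Finset.sum_pair hx, hs, hi] at this
  simp only [Option.elim] at this
  omega

theorem eq_zero_of_diag_all
    (hF : IsOutline (Option.elim · m h) (Option.elim · m h) (Option.elim · m h) F) {i : Fin k}
    (hi : F (some i) (some i) (some i) = h i * h i) {x : Option (Fin k)} (hx : x ≠ some i) :
    F (some i) (some i) x = 0 ∧ F (some i) x (some i) = 0 ∧ F x (some i) (some i) = 0 :=
  ⟨hF.eq_zero_of_diag hi hx, hF.rotate.rotate.eq_zero_of_diag (F := fun k i j => F i j k) hi hx,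
    hF.rotate.eq_zero_of_diag (F := fun j k i => F i j k) hi hx⟩

end IsOutline

open Finset in
theorem ilsExists_of_isOutline {n m k : ℕ} {h : Fin k → ℕ} (hn : ∑ i, h i + m = n)
    {F : Option (Fin k) → Option (Fin k) → Option (Fin k) → ℕ}
    (hF : IsOutline (Option.elim · m h) (Option.elim · m h) (Option.elim · m h) F)
    (hd : ∀ i, F (some i) (some i) (some i) = h i * h i) : ILSExists n h := by
  classical
  obtain ⟨G, hG, hGF⟩ := hF.exists_split_all
  have hcard : Fintype.card (Σ i : Option (Fin k), Fin (Option.elim i m h)) =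
      Fintype.card (Fin n) := by
    simp [Fintype.sum_option, ← hn, add_comm]
  -- The classes of the split array, laid out on `Fin n`; class `some i` becomes `A i` below,
  -- used as the rows, the columns and the symbols of the `i`-th subsquare.
  let e := Fintype.equivOfCardEq hcard
  have hs : ∀ x y, ∃! z, G (e.symm x) (e.symm y) (e.symm z) ≠ 0 := fun x y =>
    e.symm.bijective.existsUnique_iff.1
      (existsUnique_ne_zero_of_sum_eq_one (by simpa using hG.sum_syms (e.symm x) (e.symm y)))
  have hc : ∀ x z, ∃! y, G (e.symm x) (e.symm y) (e.symm z) ≠ 0 := fun x z =>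
    e.symm.bijective.existsUnique_iff.1
      (existsUnique_ne_zero_of_sum_eq_one (by simpa using hG.sum_cols (e.symm x) (e.symm z)))
  have hr : ∀ y z, ∃! x, G (e.symm x) (e.symm y) (e.symm z) ≠ 0 := fun y z =>
    e.symm.bijective.existsUnique_iff.1
      (existsUnique_ne_zero_of_sum_eq_one (by simpa using hG.sum_rows (e.symm y) (e.symm z)))
  choose L hL using fun x y => (hs x y).exists
  have hLG : ∀ x y z, L x y = z ↔ G (e.symm x) (e.symm y) (e.symm z) ≠ 0 := fun x y z =>
    ⟨fun h => h ▸ hL x y, fun h => (hs x y).unique (hL x y) h⟩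
  have hlat : IsLatinSquare L := by
    simp only [IsLatinSquare, hLG]
    exact ⟨hc, hr⟩
  let A : Fin k → Finset (Fin n) := fun i => {x | (e.symm x).1 = some i}
  have hA : ∀ i x, x ∈ A i ↔ (e.symm x).1 = some i := by simp [A]
  have hAcard : ∀ i, #(A i) = h i := fun i =>
    (card_bijective e.symm e.symm.bijective (by simp [A])).trans
      (card_filter_sigma_fst_eq (Option.elim · m h) (some i))
  have hAd : ∀ i j, i ≠ j → Disjoint (A i) (A j) := fun i j hij =>
    disjoint_left.2 fun x hi hj => hij (by simpa [(hA i x).1 hi] using (hA j x).1 hj)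
  have hne : ∀ x y z, L x y = z → F (e.symm x).1 (e.symm y).1 (e.symm z).1 ≠ 0 :=
    fun x y z h => hGF _ _ _ ((hLG x y z).1 h)
  refine ⟨L, hlat, fun i => ⟨A i, A i, A i⟩, fun i => ⟨hAcard i, hAcard i, hAcard i, ?_, ?_, ?_⟩,
    fun i j hij => ⟨hAd i j hij, hAd i j hij, hAd i j hij⟩⟩
  · intro x hx y hy
    have := hne x y _ rfl
    rw [(hA i x).1 hx, (hA i y).1 hy] at this
    by_contra hz
    exact this (hF.eq_zero_of_diag_all (hd i) (mt (hA i _).2 hz)).1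
  · intro x hx z hz
    obtain ⟨y, hy, hu⟩ := hlat.1 x z
    refine ⟨y, ⟨?_, hy⟩, fun y' hy' => hu y' hy'.2⟩
    have := hne x y z hy
    rw [(hA i x).1 hx, (hA i z).1 hz] at this
    by_contra hz
    exact this (hF.eq_zero_of_diag_all (hd i) (mt (hA i _).2 hz)).2.1
  · intro y hy z hz
    obtain ⟨x, hx, hu⟩ := hlat.2 y z
    refine ⟨x, ⟨?_, hx⟩, fun x' hx' => hu x' hx'.2⟩
    have := hne x y z hx
    rw [(hA i y).1 hy, (hA i z).1 hz] at this
    by_contra hz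
    exact this (hF.eq_zero_of_diag_all (hd i) (mt (hA i _).2 hz)).2.2

/-! ### The outline array for three subsquares -/

/-- The outline array for three subsquares in which each even transversal cell `(i, i + 1, i + 2)`
has multiplicity `e` and each odd one `(i, i + 2, i + 1)` multiplicity `o`. All other values are
forced by these, by the subsquares on the diagonal, and by the line sums. It takes
values in `ℤ` so that the forced values can be written as differences; `h i` is the order of the
`i`-th subsquare and `m` the size of the class `none`. -/
def tripleOutline (h : Fin 3 → ℤ) (m e o : ℤ) :
    Option (Fin 3) → Option (Fin 3) → Option (Fin 3) → ℤ
  | some i, some j, some k =>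
    if i = j ∧ j = k then h i * h i
    else if j = i + 1 ∧ k = i + 2 then e else if j = i + 2 ∧ k = i + 1 then o else 0
  | some i, some j, none =>
    if j = i then 0 else h i * h j - if j = i + 1 then e else o
  | some i, none, some k =>
    if k = i then 0 else h i * h k - if k = i + 2 then e else o
  | none, some j, some k =>
    if k = j then 0 else h j * h k - if k = j + 1 then e else o
  | some i, none, none => h i * (m - h (i + 1) - h (i + 2)) + e + o
  | none, some i, none => h i * (m - h (i + 1) - h (i + 2)) + e + o
  | none, none, some i => h i * (m - h (i + 1) - h (i + 2)) + e + o
  | none, none, none =>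
    m ^ 2 - m * (h 0 + h 1 + h 2) + 2 * (h 0 * h 1 + h 0 * h 2 + h 1 * h 2) - 3 * (e + o)

theorem tripleOutline_sums (h : Fin 3 → ℤ) (m e o : ℤ) (x y : Option (Fin 3)) :
    ∑ z, tripleOutline h m e o x y z = x.elim m h * y.elim m h ∧
    ∑ z, tripleOutline h m e o x z y = x.elim m h * y.elim m h ∧
    ∑ z, tripleOutline h m e o z x y = x.elim m h * y.elim m h := by
  have e1 : (1 : Fin 3) + 1 = 2 := rfl
  have e2 : (1 : Fin 3) + 2 = 0 := rfl
  have e3 : (2 : Fin 3) + 1 = 0 := rfl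
  have e4 : (2 : Fin 3) + 2 = 1 := rfl
  rcases x with _ | x <;> rcases y with _ | y <;> (try fin_cases x) <;> (try fin_cases y) <;>
    refine ⟨?_, ?_, ?_⟩ <;>
    simp [Fintype.sum_option, Fin.sum_univ_three, tripleOutline, e1, e2, e3, e4] <;> ring

theorem tripleOutline_nonneg {h : Fin 3 → ℤ} {m e o : ℤ} (hh : ∀ i, 0 ≤ h i) (he : 0 ≤ e)
    (ho : 0 ≤ o) (he' : ∀ i j, i ≠ j → e ≤ h i * h j) (ho' : ∀ i j, i ≠ j → o ≤ h i * h j)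
    (hA : ∀ i, h i * (h (i + 1) + h (i + 2) - m) ≤ e + o)
    (hB : 3 * (e + o) ≤
      m ^ 2 - m * (h 0 + h 1 + h 2) + 2 * (h 0 * h 1 + h 0 * h 2 + h 1 * h 2))
    (x y z : Option (Fin 3)) : 0 ≤ tripleOutline h m e o x y z := by
  have hA' : ∀ i, 0 ≤ h i * (m - h (i + 1) - h (i + 2)) + e + o := fun i => by
    linear_combination hA i
  rcases x with _ | x <;> rcases y with _ | y <;> rcases z with _ | z <;>
    simp only [tripleOutline]
  · linarith
  · exact hA' _
  · exact hA' _
  · split_ifs with h1 h2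
    · exact le_rfl
    · exact sub_nonneg.2 (he' _ _ (Ne.symm h1))
    · exact sub_nonneg.2 (ho' _ _ (Ne.symm h1))
  · exact hA' _
  · split_ifs with h1 h2
    · exact le_rfl
    · exact sub_nonneg.2 (he' _ _ (Ne.symm h1))
    · exact sub_nonneg.2 (ho' _ _ (Ne.symm h1))
  · split_ifs with h1 h2
    · exact le_rfl
    · exact sub_nonneg.2 (he' _ _ (Ne.symm h1))
    · exact sub_nonneg.2 (ho' _ _ (Ne.symm h1))
  · split_ifs
    · exact mul_nonneg (hh _) (hh _)
    · exact he
    · exact ho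
    · exact le_rfl

theorem ilsExists_of_le {n m : ℕ} {h : Fin 3 → ℕ} (hn : ∑ i, h i + m = n) {e o : ℤ} (he : 0 ≤ e)
    (ho : 0 ≤ o) (he' : ∀ i j, i ≠ j → e ≤ h i * h j) (ho' : ∀ i j, i ≠ j → o ≤ h i * h j)
    (hA : ∀ i, (h i : ℤ) * (h (i + 1) + h (i + 2) - m) ≤ e + o)
    (hB : 3 * (e + o) ≤
      (m : ℤ) ^ 2 - m * (h 0 + h 1 + h 2) + 2 * (h 0 * h 1 + h 0 * h 2 + h 1 * h 2)) :
    ILSExists n h := by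
  have hnn := tripleOutline_nonneg (h := fun i => (h i : ℤ)) (fun i => Int.natCast_nonneg _)
    he ho he' ho' hA hB
  have hs := tripleOutline_sums (fun i => (h i : ℤ)) m e o
  have hw : ∀ x : Option (Fin 3), ((x.elim m h : ℕ) : ℤ) = x.elim (m : ℤ) fun i => (h i : ℤ) := by
    rintro (_ | i) <;> rfl
  refine ilsExists_of_isOutline hn
    (F := fun x y z => (tripleOutline (fun i => (h i : ℤ)) m e o x y z).toNat)
    ⟨fun x y => ?_, fun x y => ?_, fun x y => ?_⟩ fun i => ?_
  · zify
    simp only [Int.toNat_of_nonneg (hnn _ _ _), hw, (hs x y).1]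
  · zify
    simp only [Int.toNat_of_nonneg (hnn _ _ _), hw, (hs x y).2.1]
  · zify
    simp only [Int.toNat_of_nonneg (hnn _ _ _), hw, (hs x y).2.2]
  · zify
    simp [tripleOutline, mul_self_nonneg]

/-! ### Necessary conditions for three subsquares -/

theorem sum_option_fin_three (f : Option (Fin 3) → ℕ) {i j k : Fin 3}
    (hij : i ≠ j) (hik : i ≠ k) (hjk : j ≠ k) :
    ∑ x, f x = f none + f (some i) + f (some j) + f (some k) := by
  rw [Fintype.sum_option, Fin.sum_univ_three]
  fin_cases i <;> fin_cases j <;> fin_cases k <;> simp at hij hik hjk ⊢ <;> ring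

namespace IsOutline

variable {m : ℕ} {h : Fin 3 → ℕ}
  {F : Option (Fin 3) → Option (Fin 3) → Option (Fin 3) → ℕ}

/-- The nonnegativity of `F i none none`, which the line sums express through the two transversal
cells in row class `i`. -/
theorem mul_le_add
    (hF : IsOutline (Option.elim · m h) (Option.elim · m h) (Option.elim · m h) F)
    (hd : ∀ i, F (some i) (some i) (some i) = h i * h i) {i j k : Fin 3}
    (hij : i ≠ j) (hik : i ≠ k) (hjk : j ≠ k) :
    (h i : ℤ) * (h j + h k - m) ≤
      F (some i) (some j) (some k) + F (some i) (some k) (some j) := by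
  have h1 := hF.sum_syms (some i) none
  have h2 := hF.sum_cols (some i) (some j)
  have h3 := hF.sum_cols (some i) (some k)
  have z1 := (hF.eq_zero_of_diag_all (hd i) (x := some j) (by simpa using hij.symm)).1
  have z2 := (hF.eq_zero_of_diag_all (hd i) (x := some k) (by simpa using hik.symm)).1
  have z3 := (hF.eq_zero_of_diag_all (hd j) (x := some i) (by simpa using hij)).2.2
  have z4 := (hF.eq_zero_of_diag_all (hd k) (x := some i) (by simpa using hik)).2.2
  rw [sum_option_fin_three _ hij hik hjk] at h1 h2 h3
  simp only [Option.elim] at h1 h2 h3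
  zify at *
  linear_combination h1 - h2 - h3 + z1 + z2 + z3 + z4 + Int.natCast_nonneg (F (some i) none none)
    + Int.natCast_nonneg (F (some i) none (some i))

theorem none_left_eq
    (hF : IsOutline (Option.elim · m h) (Option.elim · m h) (Option.elim · m h) F)
    (hd : ∀ i, F (some i) (some i) (some i) = h i * h i) {i j k : Fin 3}
    (hij : i ≠ j) (hik : i ≠ k) (hjk : j ≠ k) :
    (F none none (some i) : ℤ) =
      h i * (m - h j - h k) + F (some k) (some j) (some i) + F (some j) (some k) (some i) := by
  have h1 := hF.sum_cols none (some i)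
  have h2 := hF.sum_rows (some j) (some i)
  have h3 := hF.sum_rows (some k) (some i)
  have z1 := (hF.eq_zero_of_diag_all (hd i) (x := none) (by simp)).2.2
  have z2 := (hF.eq_zero_of_diag_all (hd i) (x := some j) (by simpa using hij.symm)).2.1
  have z3 := (hF.eq_zero_of_diag_all (hd i) (x := some k) (by simpa using hik.symm)).2.1
  have z4 := (hF.eq_zero_of_diag_all (hd j) (x := some i) (by simpa using hij)).1
  have z5 := (hF.eq_zero_of_diag_all (hd k) (x := some i) (by simpa using hik)).1
  rw [sum_option_fin_three _ hij hik hjk] at h1 h2 h3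
  simp only [Option.elim] at h1 h2 h3
  zify at *
  linear_combination h1 - h2 - h3 - z1 + z2 + z3 + z4 + z5

/-- The nonnegativity of `F none none none`, expressed through the six transversal cells. -/
theorem sum_transversals_le
    (hF : IsOutline (Option.elim · m h) (Option.elim · m h) (Option.elim · m h) F)
    (hd : ∀ i, F (some i) (some i) (some i) = h i * h i) :
    (F (some 0) (some 1) (some 2) + F (some 1) (some 2) (some 0) + F (some 2) (some 0) (some 1) +
      F (some 0) (some 2) (some 1) + F (some 2) (some 1) (some 0) + F (some 1) (some 0) (some 2) :
      ℤ) ≤ (m : ℤ) ^ 2 - m * (h 0 + h 1 + h 2) + 2 * (h 0 * h 1 + h 0 * h 2 + h 1 * h 2) := by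
  have h1 := hF.sum_syms none none
  rw [sum_option_fin_three _ (i := 0) (j := 1) (k := 2) (by decide) (by decide) (by decide)] at h1
  simp only [Option.elim] at h1
  zify at h1
  linear_combination h1 - hF.none_left_eq hd (i := 0) (j := 1) (k := 2) (by decide) (by decide)
      (by decide)
    - hF.none_left_eq hd (i := 1) (j := 0) (k := 2) (by decide) (by decide) (by decide)
    - hF.none_left_eq hd (i := 2) (j := 0) (k := 1) (by decide) (by decide) (by decide)
    + Int.natCast_nonneg (F none none none)

/-- The bound `mul_le_add` for class `i` as a class of rows, of columns and of symbols: these three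
inequalities together involve each of the six transversal cells once. -/
theorem three_mul_le
    (hF : IsOutline (Option.elim · m h) (Option.elim · m h) (Option.elim · m h) F)
    (hd : ∀ i, F (some i) (some i) (some i) = h i * h i) {i j k : Fin 3}
    (hij : i ≠ j) (hik : i ≠ k) (hjk : j ≠ k) :
    3 * ((h i : ℤ) * (h j + h k - m)) ≤
      (m : ℤ) ^ 2 - m * (h 0 + h 1 + h 2) + 2 * (h 0 * h 1 + h 0 * h 2 + h 1 * h 2) := by
  have h0 := hF.sum_transversals_le hd
  have h1 := hF.mul_le_add hd hij hik hjk
  have h2 := hF.rotate.mul_le_add (F := fun y z x => F x y z) hd hij hik hjk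
  have h3 := hF.rotate.rotate.mul_le_add (F := fun z x y => F x y z) hd hij hik hjk
  refine le_trans ?_ h0
  fin_cases i <;> fin_cases j <;> fin_cases k <;> simp at hij hik hjk h1 h2 h3 ⊢ <;> linarith

theorem le_mul
    (hF : IsOutline (Option.elim · m h) (Option.elim · m h) (Option.elim · m h) F)
    (i j k : Fin 3) :
    (F (some i) (some j) (some k) : ℤ) ≤ h i * h j ∧
    (F (some i) (some j) (some k) : ℤ) ≤ h i * h k ∧
    (F (some i) (some j) (some k) : ℤ) ≤ h j * h k := by
  have h1 := hF.sum_syms (some i) (some j)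
  have h2 := hF.sum_cols (some i) (some k)
  have h3 := hF.sum_rows (some j) (some k)
  have g1 := Finset.single_le_sum (f := fun z => F (some i) (some j) z)
    (fun _ _ => Nat.zero_le _) (Finset.mem_univ (some k))
  have g2 := Finset.single_le_sum (f := fun y => F (some i) y (some k))
    (fun _ _ => Nat.zero_le _) (Finset.mem_univ (some j))
  have g3 := Finset.single_le_sum (f := fun x => F x (some j) (some k))
    (fun _ _ => Nat.zero_le _) (Finset.mem_univ (some i))
  exact ⟨mod_cast g1.trans_eq h1, mod_cast g2.trans_eq h2, mod_cast g3.trans_eq h3⟩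

end IsOutline

/-! ### The existence criterion -/

/-- The uniform form of the existence criterion. The number `A` is the sum `e + o` of the
multiplicities of an even and an odd transversal cell. -/
theorem ilsExists_three_iff {n h₁ h₂ h₃ m : ℕ} (h₁₂ : h₂ ≤ h₁) (h₂₃ : h₃ ≤ h₂)
    (hn : h₁ + h₂ + h₃ + m = n) :
    ILSExists n ![h₁, h₂, h₃] ↔ ∃ A : ℤ, 0 ≤ A ∧ (h₁ : ℤ) * (h₂ + h₃ - m) ≤ A ∧
      (h₂ : ℤ) * (h₁ + h₃ - m) ≤ A ∧ (h₃ : ℤ) * (h₁ + h₂ - m) ≤ A ∧ A ≤ 2 * (h₂ * h₃) ∧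
      3 * A ≤ (m : ℤ) ^ 2 - m * (h₁ + h₂ + h₃) + 2 * (h₁ * h₂ + h₁ * h₃ + h₂ * h₃) := by
  have hn' : ∑ i, ![h₁, h₂, h₃] i + m = n := by simpa [Fin.sum_univ_three] using hn
  constructor
  · intro H
    obtain ⟨F, hF, hd⟩ := exists_isOutline_of_ilsExists hn' H
    have a0 := hF.mul_le_add hd (i := 0) (j := 1) (k := 2) (by decide) (by decide) (by decide)
    have a1 := hF.mul_le_add hd (i := 1) (j := 0) (k := 2) (by decide) (by decide) (by decide)
    have a2 := hF.mul_le_add hd (i := 2) (j := 0) (k := 1) (by decide) (by decide) (by decide)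
    have b0 := hF.three_mul_le hd (i := 0) (j := 1) (k := 2) (by decide) (by decide) (by decide)
    have b1 := hF.three_mul_le hd (i := 1) (j := 0) (k := 2) (by decide) (by decide) (by decide)
    have b2 := hF.three_mul_le hd (i := 2) (j := 0) (k := 1) (by decide) (by decide) (by decide)
    have b := (hF.sum_transversals_le hd).trans' (by positivity)
    have c0 := (hF.le_mul 0 1 2).2.2
    have c0' := (hF.le_mul 0 2 1).2.2
    have c1 := (hF.le_mul 1 0 2).2.1
    have c1' := (hF.le_mul 1 2 0).1
    have c2 := (hF.le_mul 2 0 1).2.1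
    have c2' := (hF.le_mul 2 1 0).1
    simp only [Matrix.cons_val] at a0 a1 a2 b0 b1 b2 b c0 c0' c1 c1' c2 c2'
    refine ⟨max (max 0 ((h₁ : ℤ) * (h₂ + h₃ - m)))
      (max ((h₂ : ℤ) * (h₁ + h₃ - m)) ((h₃ : ℤ) * (h₁ + h₂ - m))),
      (le_max_left _ _).trans (le_max_left _ _), (le_max_right _ _).trans (le_max_left _ _),
      (le_max_left _ _).trans (le_max_right _ _), (le_max_right _ _).trans (le_max_right _ _),
      max_le (max_le (by positivity) ?_) (max_le ?_ ?_), ?_⟩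
    · linarith
    · linarith
    · linarith
    · rcases max_choice (max 0 ((h₁ : ℤ) * (h₂ + h₃ - m)))
        (max ((h₂ : ℤ) * (h₁ + h₃ - m)) ((h₃ : ℤ) * (h₁ + h₂ - m))) with h | h <;> rw [h]
      · rcases max_choice 0 ((h₁ : ℤ) * (h₂ + h₃ - m)) with h | h <;> rw [h]
        · simpa using b
        · exact b0
      · rcases max_choice ((h₂ : ℤ) * (h₁ + h₃ - m)) ((h₃ : ℤ) * (h₁ + h₂ - m)) with h | h <;>
          rw [h]
        · exact b1
        · exact b2
  · rintro ⟨A, hA, hA₁, hA₂, hA₃, hAU, hAB⟩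
    have hU : ∀ i j : Fin 3, i ≠ j →
        (h₂ * h₃ : ℤ) ≤ (![h₁, h₂, h₃] i : ℤ) * (![h₁, h₂, h₃] j : ℤ) := by
      intro i j hij
      have p1 : (h₂ * h₃ : ℤ) ≤ h₁ * h₂ := mod_cast (by nlinarith)
      have p2 : (h₂ * h₃ : ℤ) ≤ h₁ * h₃ := mod_cast (by nlinarith)
      fin_cases i <;> fin_cases j <;> simp at hij ⊢ <;> linarith
    -- Any split of `A` into two parts of size at most `h₂ * h₃` would do.
    refine ilsExists_of_le hn' (e := min A (h₂ * h₃)) (o := A - min A (h₂ * h₃))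
      (le_min hA (by positivity)) (sub_nonneg.2 (min_le_left _ _))
      (fun i j hij => (min_le_right _ _).trans (hU i j hij))
      (fun i j hij => (sub_le_iff_le_add.2 ?_ : _ ≤ (h₂ * h₃ : ℤ)).trans (hU i j hij)) ?_ ?_
    · rcases min_choice A (h₂ * h₃ : ℤ) with h | h <;> rw [h]
      · nlinarith [Int.natCast_nonneg (h₂ * h₃)]
      · linarith
    · rw [add_sub_cancel]
      intro i
      fin_cases i
      · simpa using hA₁
      · simpa [show (1 : Fin 3) + 1 = 2 from rfl, show (1 : Fin 3) + 2 = 0 from rfl, add_comm]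
          using hA₂
      · simpa [show (2 : Fin 3) + 1 = 0 from rfl, show (2 : Fin 3) + 2 = 1 from rfl] using hA₃
    · rw [add_sub_cancel]
      simpa using hAB

/-- For `m ≥ a` the quadratic bound of `ilsExists_three_iff` holds automatically. -/
theorem quadratic_bounds_of_ge {a b c m : ℤ} (hc : 0 < c) (hcb : c ≤ b) (hba : b ≤ a)
    (ham : a ≤ m) :
    0 ≤ m ^ 2 - m * (a + b + c) + 2 * (a * b + a * c + b * c) ∧
    3 * (c * (a + b - m)) ≤ m ^ 2 - m * (a + b + c) + 2 * (a * b + a * c + b * c) := by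
  obtain ⟨t, rfl⟩ := Int.le.dest ham
  have ht := Int.natCast_nonneg t
  generalize (t : ℤ) = t at ht ham ⊢
  have hab : 0 ≤ a * b := by nlinarith
  have hbc : 0 < b * c := by nlinarith
  have hac : 0 < a * c := by nlinarith
  constructor
  · rcases le_total (b + c) (a + t) with h | h
    · linear_combination mul_nonneg ht (sub_nonneg.2 h) + hab + hac + 2 * hbc
    · have h1 : t * (b + c - (a + t)) ≤ c * b :=
        mul_le_mul (by linarith) (by linarith) (by linarith) hc.le
      linear_combination h1 + hab + hac + hbc
  · have h1 := mul_nonneg ht (by linarith : 0 ≤ a - b + 2 * c)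
    have h2 := mul_nonneg hc.le (sub_nonneg.2 hba)
    linear_combination sq_nonneg t + h1 + h2 + hab

/-- For `c ≤ m < a` the quadratic bound of `ilsExists_three_iff` follows from `a - c ≤ m`. -/
theorem quadratic_bound_of_le_of_lt {a b c m : ℤ} (hc : 0 < c) (hcb : c ≤ b) (hba : b ≤ a)
    (hcm : c ≤ m) (hma : m < a) (hm : a - c ≤ m) :
    3 * (b * (a + c - m)) ≤ m ^ 2 - m * (a + b + c) + 2 * (a * b + a * c + b * c) := by
  rcases le_total (2 * c) a with h | h
  · have h1 := mul_nonneg (sub_nonneg.2 hm) (by linarith : 0 ≤ a - 3 * c + 2 * b)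
    have h2 : 0 ≤ b * (a - 3 * c) + 2 * c ^ 2 := by
      rcases le_total (3 * c) a with h' | h'
      · nlinarith
      · linear_combination mul_nonneg (sub_nonneg.2 hba) (sub_nonneg.2 h')
          + sq_nonneg (a - 2 * c) + mul_nonneg hc.le (sub_nonneg.2 h)
    linear_combination sq_nonneg (m - (a - c)) + h1 + h2
  · have h1 := mul_nonneg (sub_nonneg.2 hcm) (by linarith : 0 ≤ c - a + 2 * b)
    have h2 := mul_nonneg (sub_nonneg.2 hba) (by linarith : 0 ≤ a - c)
    have h3 := mul_nonneg (hc.le.trans (hcb.trans hba)) (sub_nonneg.2 h)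
    linear_combination sq_nonneg (m - c) + h1 + h2 + h3

theorem mainTheorem4 (n h₁ h₂ h₃ h₄ : ℕ) (h₁₂ : h₂ ≤ h₁) (h₂₃ : h₃ ≤ h₂) (h₃_pos : 0 < h₃)
    (hn : h₁ + h₂ + h₃ + h₄ = n) :
    (h₁ ≤ h₄ → ILSExists n ![h₁, h₂, h₃]) ∧
    (h₄ < h₁ → h₃ ≤ h₄ →
      (ILSExists n ![h₁, h₂, h₃] ↔ (h₁ : ℝ) - (h₃ : ℝ) ≤ (h₄ : ℝ))) ∧
    (h₄ < h₃ →
      (ILSExists n ![h₁, h₂, h₃] ↔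
        (h₂ : ℝ) + (h₃ : ℝ) - 2 * ((h₂ : ℝ) * (h₃ : ℝ) / (h₁ : ℝ)) ≤ (h₄ : ℝ) ∧
        0 ≤ (h₄ : ℝ) ^ 2 + (h₄ : ℝ) * (2 * (h₁ : ℝ) - (h₂ : ℝ) - (h₃ : ℝ))
          - (h₁ : ℝ) * (h₂ : ℝ) - (h₁ : ℝ) * (h₃ : ℝ) + 2 * (h₂ : ℝ) * (h₃ : ℝ))) := by

  rw [ilsExists_three_iff h₁₂ h₂₃ hn]
  have hh₁ : (0 : ℤ) < h₁ := mod_cast h₃_pos.trans_le (h₂₃.trans h₁₂)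
  have hh₁' : (0 : ℝ) < h₁ := mod_cast hh₁
  have hh₂ : (0 : ℤ) < h₂ := mod_cast h₃_pos.trans_le h₂₃
  have hh₃ : (0 : ℤ) < h₃ := mod_cast h₃_pos
  have i₁₂ : (h₂ : ℤ) ≤ h₁ := mod_cast h₁₂
  have i₂₃ : (h₃ : ℤ) ≤ h₂ := mod_cast h₂₃
  have i₄ : (0 : ℤ) ≤ h₄ := Int.natCast_nonneg _
  have c₂ : (h₁ : ℝ) - (h₃ : ℝ) ≤ (h₄ : ℝ) ↔ (h₁ : ℤ) - h₃ ≤ h₄ := by exact_mod_cast Iff.rfl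
  have c₃ : (h₂ : ℝ) + (h₃ : ℝ) - 2 * ((h₂ : ℝ) * (h₃ : ℝ) / (h₁ : ℝ)) ≤ (h₄ : ℝ) ↔
      (h₁ : ℤ) * (h₂ + h₃ - h₄) ≤ 2 * (h₂ * h₃) := by
    rw [sub_le_comm, ← mul_div_assoc, le_div_iff₀' hh₁']
    exact_mod_cast Iff.rfl
  have c₄ : 0 ≤ (h₄ : ℝ) ^ 2 + (h₄ : ℝ) * (2 * (h₁ : ℝ) - (h₂ : ℝ) - (h₃ : ℝ))
          - (h₁ : ℝ) * (h₂ : ℝ) - (h₁ : ℝ) * (h₃ : ℝ) + 2 * (h₂ : ℝ) * (h₃ : ℝ) ↔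
      0 ≤ (h₄ : ℤ) ^ 2 + h₄ * (2 * h₁ - h₂ - h₃) - h₁ * h₂ - h₁ * h₃ + 2 * h₂ * h₃ := by
    exact_mod_cast Iff.rfl
  rw [c₂, c₃, c₄]
  -- With `Aᵢ = hᵢ * (hⱼ + hₖ - h₄)`, the largest of `A₁, A₂, A₃` is `A₃` if `h₄ ≥ h₁`, `A₂` if
  -- `h₁ > h₄ ≥ h₃`, and `A₁` if `h₄ < h₃`; the witness for `A` is the largest of them and `0`.
  refine ⟨fun h => ?_, fun h h' => ⟨?_, fun hm => ?_⟩, fun h => ⟨?_, ?_⟩⟩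
  · have h : (h₁ : ℤ) ≤ h₄ := mod_cast h
    obtain ⟨B₀, B₃⟩ := quadratic_bounds_of_ge hh₃ i₂₃ i₁₂ h
    have d₁ := mul_nonneg (sub_nonneg.2 (i₂₃.trans i₁₂)) (sub_nonneg.2 (i₁₂.trans h))
    have d₂ := mul_nonneg (sub_nonneg.2 i₂₃) (sub_nonneg.2 h)
    rcases le_total 0 ((h₃ : ℤ) * (h₁ + h₂ - h₄)) with hA | hA
    · refine ⟨_, hA, ?_, ?_, le_rfl, ?_, B₃⟩
      · linear_combination d₁
      · linear_combination d₂
      · linear_combination mul_nonneg hh₃.le (sub_nonneg.2 h) + mul_pos hh₂ hh₃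
    · refine ⟨0, le_rfl, ?_, ?_, hA, by positivity, by linarith⟩
      · linear_combination d₁ + hA
      · linear_combination d₂ + hA
  · rintro ⟨A, -, -, hA, -, hU, -⟩
    have := le_of_mul_le_mul_left (show (h₂ : ℤ) * (h₁ + h₃ - h₄) ≤ h₂ * (2 * h₃) by linarith) hh₂
    linarith
  · have h : (h₄ : ℤ) < h₁ := mod_cast h
    have h' : (h₃ : ℤ) ≤ h₄ := mod_cast h'
    refine ⟨(h₂ : ℤ) * (h₁ + h₃ - h₄), mul_nonneg hh₂.le (by linarith), ?_, le_rfl, ?_, ?_,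
      quadratic_bound_of_le_of_lt hh₃ i₂₃ i₁₂ h' h hm⟩
    · linear_combination mul_nonneg (sub_nonneg.2 i₁₂) (sub_nonneg.2 h')
    · linear_combination mul_nonneg (sub_nonneg.2 i₂₃) (sub_nonneg.2 h.le)
    · linear_combination mul_nonneg hh₂.le (sub_nonneg.2 hm)
  · rintro ⟨A, -, hA, -, -, hU, hB⟩
    exact ⟨hA.trans hU, by linear_combination hB + 3 * hA⟩
  · rintro ⟨hU, hB⟩
    have h : (h₄ : ℤ) < h₃ := mod_cast h
    refine ⟨(h₁ : ℤ) * (h₂ + h₃ - h₄), mul_nonneg hh₁.le (by linarith), le_rfl, ?_, ?_, hU, ?_⟩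
    · linear_combination mul_nonneg (sub_nonneg.2 i₁₂) (sub_nonneg.2 h.le)
    · linear_combination mul_nonneg (sub_nonneg.2 (i₂₃.trans i₁₂)) (sub_nonneg.2 (h.le.trans i₂₃))
    · linear_combination hB
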